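/- Let $X$ be a Hausdorff complex topological vector space that is locally convex or, more generally, locally pseudo-convex (it has a base of zero neighborhoods $U$ with $U+U\subseteq\alpha U$ for some $\alpha>0$ depending on $U$); no completeness is assumed. Let $K\colon X\to X$ be a compact linear operator, i.e. $K$ maps some zero neighborhood into a set with compact closure. Then $r(K)=|\sigma(K)|$, where $|\sigma(K)|=\sup\{|\lambda| : \lambda\in\sigma(K)\}$ (with $\sup\emptyset=0$) and $\sigma(K)$ and $r(K)$ are defined as follows. Call a linear operator $T$ on $X$ bb-bounded if it maps bounded sets to bounded sets, nn-bounded if there is a base $\mathcal N_0$ of zero neighborhoods such that every $U\in\mathcal N_0$ satisfies $T(U)\subseteq\alpha U$ for some $\alpha>0$, and nb-bounded if it maps some zero neighborhood to a bounded set. (Bases of zero neighborhoods consist of balanced sets and are closed under multiplication by nonzero scalars.) Let $\sigma^{bb}(K)$, $\sigma^{c}(K)$, $\sigma^{nn}(K)$, $\sigma^{nb}(K)$ be the set of all $\lambda\in\mathbb C$ for which $\lambda I-K$ does not have a two-sided linear inverse that is, respectively, bb-bounded, continuous, nn-bounded, or of the form $\alpha I+S$ with $\alpha\in\mathbb C$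 and $S$ nb-bounded. Let $r_{bb}(K)$, $r_c(K)$, $r_{nn}(K)$, $r_{nb}(K)$ be the infimum in $[0,\infty]$ of all $\nu>0$ such that $S_n=K^n/\nu^n$ tends to zero, respectively, - uniformly on every bounded set; - equicontinuously: for every zero neighborhood $V$ there is a zero neighborhood $U$ such that for every $\varepsilon>0$ one has $S_n(U)\subseteq\varepsilon V$ for all large $n$; - in the sense of nn-convergence: there is a base $\mathcal N_0$ of zero neighborhoods such that for all $U\in\mathcal N_0$ and $\varepsilon>0$ one has $S_n(U)\subseteq\varepsilon U$ for all large $n$; - uniformly on some zero neighborhood. Then $\sigma^{bb}(K)=\sigma^{c}(K)=\sigma^{nn}(K)=\sigma^{nb}(K)$, and this common set is $\sigma(K)$; also $r_{bb}(K)=r_c(K)=r_{nn}(K)=r_{nb}(K)$, and this common number is $r(K)$; and $r(K)=|\sigma(K)|$. -/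

import Mathlib

namespace TVSOp

open Filter Set
open scoped Topology Pointwise ENNReal

section Space

variable {X : Type*} [AddCommGroup X] [Module ℂ X]

/-- A set `A` is pseudo-convex if `A + A ⊆ α A` for some number `α`. -/
def IsPseudoconvex (A : Set X) : Prop :=
  ∃ α : ℝ, 0 < α ∧ A + A ⊆ (α : ℂ) • A

variable [TopologicalSpace X]

variable (X) in
/-- The zero neighborhoods have a base that consists of pseudo-convex sets. -/
def LocallyPseudoconvex : Prop :=
  ∀ V ∈ 𝓝 (0 : X), ∃ U ∈ 𝓝 (0 : X), U ⊆ V ∧ IsPseudoconvex U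

/-- A base of balanced zero neighborhoods that is stable under multiplication by nonzero scalars.
The two other usual requirements on such a base are consequences, see `IsZeroBase.exists_inter`
and `IsZeroBase.exists_add` below. -/
structure IsZeroBase (B : Set (Set X)) : Prop where
  mem_nhds : ∀ U ∈ B, U ∈ 𝓝 (0 : X)
  exists_subset : ∀ V ∈ 𝓝 (0 : X), ∃ U ∈ B, U ⊆ V
  balanced : ∀ U ∈ B, Balanced ℂ U
  smul_mem : ∀ U ∈ B, ∀ c : ℂ, c ≠ 0 → c • U ∈ B

theorem IsZeroBase.exists_inter {B : Set (Set X)} (hB : IsZeroBase B) {U V : Set X}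
    (hU : U ∈ B) (hV : V ∈ B) : ∃ W ∈ B, W ⊆ U ∩ V :=
  hB.exists_subset _ (inter_mem (hB.mem_nhds U hU) (hB.mem_nhds V hV))

theorem IsZeroBase.exists_add [IsTopologicalAddGroup X] {B : Set (Set X)} (hB : IsZeroBase B)
    {V : Set X} (hV : V ∈ B) : ∃ U ∈ B, U + U ⊆ V := by
  obtain ⟨W, hW, h⟩ := exists_nhds_zero_half (hB.mem_nhds V hV)
  obtain ⟨U, hU, hUW⟩ := hB.exists_subset W hW
  refine ⟨U, hU, ?_⟩
  rintro _ ⟨a, ha, b, hb, rfl⟩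
  exact h a (hUW ha) b (hUW hb)

end Space

section Operators

variable {X : Type*} [AddCommGroup X] [Module ℂ X] [TopologicalSpace X]

/-! Four classes of linear operators. -/

/-- `T` maps bounded sets to bounded sets. -/
def BBBounded (T : Module.End ℂ X) : Prop :=
  ∀ A : Set X, Bornology.IsVonNBounded ℂ A → Bornology.IsVonNBounded ℂ (T '' A)

/-- `T` maps every member of some base of zero neighborhoods into a multiple of itself. -/
def NNBounded (T : Module.End ℂ X) : Prop :=
  ∃ B : Set (Set X), IsZeroBase B ∧ ∀ U ∈ B, ∃ α : ℝ, 0 < α ∧ T '' U ⊆ (α : ℂ) • U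

/-- `T` maps some zero neighborhood to a bounded set. -/
def NBBounded (T : Module.End ℂ X) : Prop :=
  ∃ U ∈ 𝓝 (0 : X), Bornology.IsVonNBounded ℂ (T '' U)

/-- `T` belongs to the unitalization of the algebra of nb-bounded operators. -/
def NBBoundedModScalar (T : Module.End ℂ X) : Prop :=
  ∃ (α : ℂ) (S : Module.End ℂ X), NBBounded S ∧ T = α • 1 + S

/-! The corresponding spectra. -/

/-- The complement of the set of all `z` such that `zI - T` has a two-sided linear inverse
that belongs to the class `P`. -/
def spectrumIn {X : Type*} [AddCommGroup X] [Module ℂ X]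
    (P : Module.End ℂ X → Prop) (T : Module.End ℂ X) : Set ℂ :=
  {z : ℂ | ∃ R : Module.End ℂ X, R * (z • 1 - T) = 1 ∧ (z • 1 - T) * R = 1 ∧ P R}ᶜ

def spectrumBB (T : Module.End ℂ X) : Set ℂ := spectrumIn BBBounded T

def spectrumC (T : Module.End ℂ X) : Set ℂ := spectrumIn (fun R => Continuous R) T

def spectrumNN (T : Module.End ℂ X) : Set ℂ := spectrumIn NNBounded T

def spectrumNB (T : Module.End ℂ X) : Set ℂ := spectrumIn NBBoundedModScalar T

/-- The geometrical radius `sup {|z| : z ∈ s}` of a set of complex numbers; it is `0` for the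
empty set. -/
noncomputable def geomRadius (s : Set ℂ) : ℝ≥0∞ := ⨆ z ∈ s, ‖z‖ₑ

/-! Modes of convergence to zero of a sequence of operators. -/

/-- `S n` tends to zero uniformly on `A`. -/
def UnifNullOn (S : ℕ → Module.End ℂ X) (A : Set X) : Prop :=
  ∀ V ∈ 𝓝 (0 : X), ∀ᶠ n in atTop, S n '' A ⊆ V

/-- `S n` tends to zero uniformly on every bounded set. -/
def BBNull (S : ℕ → Module.End ℂ X) : Prop :=
  ∀ A : Set X, Bornology.IsVonNBounded ℂ A → UnifNullOn S A

/-- `S n` tends to zero equicontinuously. -/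
def EquicontNull (S : ℕ → Module.End ℂ X) : Prop :=
  ∀ V ∈ 𝓝 (0 : X), ∃ U ∈ 𝓝 (0 : X), ∀ ε : ℝ, 0 < ε →
    ∀ᶠ n in atTop, S n '' U ⊆ (ε : ℂ) • V

/-- `S n` nn-converges to zero. -/
def NNNull (S : ℕ → Module.End ℂ X) : Prop :=
  ∃ B : Set (Set X), IsZeroBase B ∧ ∀ U ∈ B, ∀ ε : ℝ, 0 < ε →
    ∀ᶠ n in atTop, S n '' U ⊆ (ε : ℂ) • U

/-- `S n` tends to zero uniformly on some zero neighborhood. -/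
def NBNull (S : ℕ → Module.End ℂ X) : Prop :=
  ∃ U ∈ 𝓝 (0 : X), UnifNullOn S U

/-! The corresponding spectral radii, with values in `[0, ∞]`. -/

/-- The infimum in `[0, ∞]` of all real `ν > 0` such that the sequence `T ^ n / ν ^ n` tends to
zero in the sense of `C`. -/
noncomputable def radiusIn {X : Type*} [AddCommGroup X] [Module ℂ X]
    (C : (ℕ → Module.End ℂ X) → Prop) (T : Module.End ℂ X) : ℝ≥0∞ :=
  sInf (ENNReal.ofReal '' {ν : ℝ | 0 < ν ∧ C (fun n => ((ν : ℂ) ^ n)⁻¹ • T ^ n)})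

noncomputable def radiusBB (T : Module.End ℂ X) : ℝ≥0∞ := radiusIn BBNull T

noncomputable def radiusC (T : Module.End ℂ X) : ℝ≥0∞ := radiusIn EquicontNull T

noncomputable def radiusNN (T : Module.End ℂ X) : ℝ≥0∞ := radiusIn NNNull T

noncomputable def radiusNB (T : Module.End ℂ X) : ℝ≥0∞ := radiusIn NBNull T

end Operators

end TVSOp

/-! A compact operator `K` is nb-bounded, and this makes all spectra and all radii coincide. The
classes of operators are nested, and so are the modes of convergence. The identity `zR = 1 + RK` for
the resolvent, and `K ^ (n + 1) = K ^ n * K` for the powers, lead from the weakest notion back to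
the strongest (`spectrum_eq`, `radius_eq`).

For `r(K) ≤ |σ(K)|`, fix one balanced pseudo-convex zero neighborhood `U` with `K(U)` bounded.
Outside the disc of radius `|σ(K)|` the resolvent maps `U` into multiples of `U`. The growth rate of
powers on `U` is a submultiplicative seminorm on commuting operators (`growthSeminorm`): although
`U` need not be convex, adding `n` vectors costs only a factor polynomial in `n`. Gelfand's formula
in the completion of a commutative algebra containing `K` and its resolvents then bounds the growth
of `K ^ n` on `U` (`GrowthBound.of_resolvent`). One more application of `K` turns this into
nb-convergence.

For `|σ(K)| ≤ r(K)`, let `K ^ n / ν ^ n` tend to zero, `‖z‖ > ν` and `T = K / z`. Some power of `T`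
is small on a pseudo-convex neighborhood and maps it into a compact set. Its Neumann series need not
converge a priori, but the partial sums stay in a compact set, and a cluster point solves the
equation; compactness replaces completeness (`exists_continuous_inverse_one_sub`). A finite
geometric sum passes from the power to `T`. -/

namespace TVSOp

open Filter Set
open scoped Topology Pointwise ENNReal

/-! ### Gelfand's formula without completeness -/

section SeminormedAlgebra

/-- The spectral radius formula for a commutative algebra with a submultiplicative seminorm:
completeness is not needed for this half of the formula. -/
theorem exists_seminorm_pow_lt {A : Type*} [CommRing A] [Algebra ℂ A] (p : RingSeminorm A)
    (hp : ∀ (z : ℂ) (a : A), p (z • a) ≤ ‖z‖ * p a) (a : A) {ν ρ : ℝ} (hν : 0 ≤ ν) (h : ν < ρ)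
    (hu : ∀ z : ℂ, ν < ‖z‖ → IsUnit (algebraMap ℂ A z - a)) :
    ∃ n : ℕ, n ≠ 0 ∧ p (a ^ n) < ρ ^ n := by
  let : SeminormedCommRing A :=
    { p.toSeminormedRing with mul_comm := mul_comm }
  let : NormedAlgebra ℂ A :=
    { (inferInstance : Algebra ℂ A) with norm_smul_le := hp }
  let φ : A →+* UniformSpace.Completion A := UniformSpace.Completion.coeRingHom
  have hφ : ∀ z : ℂ, φ (algebraMap ℂ A z) = algebraMap ℂ _ z := fun z => rfl
  have hnorm : ∀ b, ‖φ b‖ = p b := fun b => UniformSpace.Completion.norm_coe b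
  -- Units stay units in the completion, so passing to it can only shrink the spectrum.
  have hrad : spectralRadius ℂ (φ a) ≤ ENNReal.ofReal ν := by
    refine iSup₂_le fun z hz => ?_
    by_contra hlt
    refine hz ?_
    have hz' : ν < ‖z‖ := by
      rw [not_le, ← enorm_eq_nnnorm, ← ofReal_norm] at hlt
      exact lt_of_not_ge fun hle => absurd hlt (not_lt.2 (ENNReal.ofReal_le_ofReal hle))
    have := (hu z hz').map φ
    rwa [map_sub, hφ] at this
  have hlim := spectrum.pow_norm_pow_one_div_tendsto_nhds_spectralRadius (φ a)
  have hlt : spectralRadius ℂ (φ a) < ENNReal.ofReal ρ :=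
    hrad.trans_lt ((ENNReal.ofReal_lt_ofReal_iff (hν.trans_lt h)).2 h)
  obtain ⟨n, hn, hn0⟩ := ((hlim.eventually_lt_const hlt).and (eventually_ne_atTop 0)).exists
  refine ⟨n, hn0, ?_⟩
  rw [ENNReal.ofReal_lt_ofReal_iff (hν.trans_lt h), ← map_pow, hnorm] at hn
  have h0 : 0 ≤ p (a ^ n) := apply_nonneg p _
  calc p (a ^ n) = (p (a ^ n) ^ (1 / n : ℝ)) ^ n := by
        rw [one_div, Real.rpow_inv_natCast_pow h0 hn0]
    _ < ρ ^ n := pow_lt_pow_left₀ hn (Real.rpow_nonneg h0 _) hn0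

end SeminormedAlgebra

/-! ### Growth of the powers of an operator on one pseudo-convex set -/

section Growth

/-- Since `2 ^ n.size ≤ 2 * (n + 1)`, the factor `α ^ n.size` grows at most polynomially and is
beaten by `t ^ n`. It is the price for adding `n + 1` vectors in `GrowthBound.add`. -/
theorem exists_pow_size_mul_pow_le (α : ℝ) (hα : 0 < α) {t : ℝ} (ht : 0 < t) (ht1 : t < 1) :
    ∃ C : ℝ, 0 < C ∧ ∀ n : ℕ, α ^ n.size * t ^ n ≤ C := by
  obtain ⟨m, hm⟩ := pow_unbounded_of_one_lt α one_lt_two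
  have hlim := (tendsto_pow_const_mul_const_pow_of_abs_lt_one m
    (by rwa [abs_of_pos ht] : |t| < 1))
  obtain ⟨C, hC⟩ := hlim.bddAbove_range
  have hC' : ∀ n : ℕ, (n : ℝ) ^ m * t ^ n ≤ C := fun n => hC (mem_range_self n)
  have hC0 : 0 < C := lt_of_lt_of_le (by simpa using ht) (hC' 1)
  refine ⟨2 ^ m * (C / t), by positivity, fun n => ?_⟩
  have hsize : 2 ^ n.size ≤ 2 * (n + 1) := by
    rcases Nat.eq_zero_or_pos n with rfl | hn
    · simp
    · have h1 : 0 < n.size := Nat.size_pos.2 hn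
      have h2 : 2 ^ (n.size - 1) ≤ n := Nat.lt_size.1 (by omega)
      have h3 : 2 ^ n.size = 2 * 2 ^ (n.size - 1) := by
        rw [← pow_succ']; congr 1; omega
      omega
  have hsize' : (2 : ℝ) ^ n.size ≤ 2 * (n + 1) := by exact_mod_cast hsize
  have h1 : α ^ n.size ≤ (2 * (n + 1)) ^ m :=
    calc α ^ n.size ≤ (2 ^ m) ^ n.size := pow_le_pow_left₀ hα.le hm.le _
      _ = (2 ^ n.size) ^ m := by rw [← pow_mul, ← pow_mul, mul_comm]
      _ ≤ _ := pow_le_pow_left₀ (by positivity) hsize' _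
  have h2 := hC' (n + 1)
  push_cast at h2
  calc α ^ n.size * t ^ n ≤ (2 * (n + 1)) ^ m * t ^ n := by gcongr
    _ = 2 ^ m * ((((n : ℝ) + 1) ^ m * t ^ (n + 1)) / t) := by
        rw [mul_pow, pow_succ]; field_simp
    _ ≤ 2 ^ m * (C / t) := by gcongr

variable {X : Type*} [AddCommGroup X] [Module ℂ X] {U : Set X}

theorem smul_subset_smul (hU : Balanced ℂ U) {c d : ℝ} (hc : 0 ≤ c) (h : c ≤ d) :
    (c : ℂ) • U ⊆ (d : ℂ) • U :=
  hU.smul_mono (by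
    rwa [Complex.norm_real, Complex.norm_real, Real.norm_of_nonneg hc,
      Real.norm_of_nonneg (hc.trans h)])

theorem smul_mem_smul (hU : Balanced ℂ U) {z : ℂ} {c : ℝ} (h : ‖z‖ ≤ c) {x : X} (hx : x ∈ U) :
    z • x ∈ (c : ℂ) • U :=
  hU.smul_mono (by rwa [Complex.norm_real, Real.norm_of_nonneg ((norm_nonneg z).trans h)])
    (smul_mem_smul_set hx)

theorem add_mem_smul {α : ℝ} (hα : U + U ⊆ (α : ℂ) • U) {c : ℝ} {x y : X}
    (hx : x ∈ (c : ℂ) • U) (hy : y ∈ (c : ℂ) • U) : x + y ∈ ((α * c : ℝ) : ℂ) • U := by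
  obtain ⟨u, hu, rfl⟩ := hx
  obtain ⟨v, hv, rfl⟩ := hy
  obtain ⟨w, hw, h⟩ := hα (add_mem_add hu hv)
  refine ⟨w, hw, ?_⟩
  simp only at h ⊢
  rw [← smul_add, ← h, smul_smul]
  push_cast
  rw [mul_comm]

/-- Repeated halving of the sum uses pseudo-convexity only `k` times in depth; adding the terms one
by one would cost a power of `α` exponential in `k`. -/
theorem sum_range_two_pow_mem_smul {α : ℝ} (hα : U + U ⊆ (α : ℂ) • U) {c : ℝ} (k : ℕ) :
    ∀ f : ℕ → X, (∀ i, f i ∈ (c : ℂ) • U) →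
      ∑ i ∈ Finset.range (2 ^ k), f i ∈ ((α ^ k * c : ℝ) : ℂ) • U := by
  induction k with
  | zero => intro f hf; simpa using hf 0
  | succ k ih =>
    intro f hf
    rw [pow_succ 2 k, mul_two, Finset.sum_range_add, pow_succ' α, mul_assoc]
    exact add_mem_smul hα (ih f hf) (ih (fun i => f (2 ^ k + i)) fun i => hf _)

theorem image_mul_subset {S T : Module.End ℂ X} {c d : ℝ} (hS : S '' U ⊆ (c : ℂ) • U)
    (hT : T '' U ⊆ (d : ℂ) • U) : (S * T) '' U ⊆ ((c * d : ℝ) : ℂ) • U := by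
  rintro _ ⟨x, hx, rfl⟩
  obtain ⟨u, hu, h⟩ := hT (mem_image_of_mem T hx)
  obtain ⟨v, hv, h'⟩ := hS (mem_image_of_mem S hu)
  refine ⟨v, hv, ?_⟩
  simp only at h h' ⊢
  rw [Module.End.mul_apply, ← h, map_smul, ← h', smul_smul]
  push_cast
  rw [mul_comm]

theorem image_smul_one_subset (hU : Balanced ℂ U) (z : ℂ) :
    (z • (1 : Module.End ℂ X)) '' U ⊆ ((‖z‖ : ℝ) : ℂ) • U := by
  rintro _ ⟨x, hx, rfl⟩
  exact smul_mem_smul hU le_rfl hx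

variable (U) in
/-- The subalgebra of all operators that map `U` into a multiple of `U`. -/
def scalingSubalgebra (hU : Balanced ℂ U) (hp : IsPseudoconvex U) :
    Subalgebra ℂ (Module.End ℂ X) where
  carrier := {T | ∃ c : ℝ, 0 < c ∧ T '' U ⊆ (c : ℂ) • U}
  mul_mem' := by
    rintro S T ⟨c, hc, hS⟩ ⟨d, hd, hT⟩
    exact ⟨c * d, mul_pos hc hd, image_mul_subset hS hT⟩
  add_mem' := by
    rintro S T ⟨c, hc, hS⟩ ⟨d, hd, hT⟩
    obtain ⟨α, hα, h⟩ := hp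
    refine ⟨α * max c d, by positivity, ?_⟩
    rintro _ ⟨x, hx, rfl⟩
    exact add_mem_smul h
      (smul_subset_smul hU hc.le (le_max_left _ _) (hS (mem_image_of_mem S hx)))
      (smul_subset_smul hU hd.le (le_max_right _ _) (hT (mem_image_of_mem T hx)))
  algebraMap_mem' z := by
    -- The summand `1` keeps the factor positive for `z = 0`.
    refine ⟨‖z‖ + 1, by positivity, ?_⟩
    rw [Algebra.algebraMap_eq_smul_one]
    exact (image_smul_one_subset hU z).trans
      (smul_subset_smul hU (norm_nonneg z) (by linarith))

variable (U) in
/-- The powers of `T` grow on `U` at most like the powers of `ν`. -/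
def GrowthBound (T : Module.End ℂ X) (ν : ℝ) : Prop :=
  ∃ M : ℝ, 0 < M ∧ ∀ n : ℕ, (T ^ n) '' U ⊆ ((M * ν ^ n : ℝ) : ℂ) • U

namespace GrowthBound

variable {S T : Module.End ℂ X} {ν μ : ℝ}

theorem of_image_subset {c : ℝ} (h : T '' U ⊆ (c : ℂ) • U) :
    GrowthBound U T c := by
  refine ⟨1, one_pos, fun n => ?_⟩
  induction n with
  | zero => simp
  | succ n ih =>
    have := image_mul_subset ih h
    rwa [← pow_succ, one_mul, ← pow_succ, ← one_mul (c ^ _)] at this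

theorem mono (hU : Balanced ℂ U) (h : GrowthBound U T ν) (hν : 0 ≤ ν) (hle : ν ≤ μ) :
    GrowthBound U T μ := by
  obtain ⟨M, hM, h⟩ := h
  exact ⟨M, hM, fun n => (h n).trans (smul_subset_smul hU (by positivity) (by gcongr))⟩

theorem mul (hST : Commute S T) (hS : GrowthBound U S ν) (hT : GrowthBound U T μ) :
    GrowthBound U (S * T) (ν * μ) := by
  obtain ⟨M, hM, hS⟩ := hS
  obtain ⟨N, hN, hT⟩ := hT
  refine ⟨M * N, mul_pos hM hN, fun n => ?_⟩
  have := image_mul_subset (hS n) (hT n)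
  rwa [← hST.mul_pow, mul_mul_mul_comm, ← mul_pow] at this

/-- Each term of the binomial expansion maps `U` into `M N (ν + μ) ^ n • U`. Summing them dyadically
costs a subexponential factor, which the gap between `ν + μ` and `ρ` absorbs. -/
theorem add (hU : Balanced ℂ U) (hp : IsPseudoconvex U) (hST : Commute S T)
    (hS : GrowthBound U S ν) (hT : GrowthBound U T μ) (hν : 0 < ν) (hμ : 0 < μ) {ρ : ℝ}
    (hρ : ν + μ < ρ) : GrowthBound U (S + T) ρ := by
  obtain ⟨M, hM, hS⟩ := hS
  obtain ⟨N, hN, hT⟩ := hT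
  obtain ⟨α, hα, hp⟩ := hp
  have hρ0 : 0 < ρ := by linarith
  obtain ⟨C, hC, hbd⟩ := exists_pow_size_mul_pow_le α hα (t := (ν + μ) / ρ) (by positivity)
    ((div_lt_one hρ0).2 hρ)
  refine ⟨C * (M * N), by positivity, fun n => ?_⟩
  rintro _ ⟨x, hx, rfl⟩
  set f : ℕ → X := fun i => (S ^ i * T ^ (n - i) * (n.choose i : Module.End ℂ X)) x with hf
  have hsum : ((S + T) ^ n) x = ∑ i ∈ Finset.range (2 ^ n.size), f i := by
    rw [hST.add_pow, LinearMap.sum_apply]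
    -- The sum is padded to length a power of two; the new binomial coefficients vanish.
    refine Finset.sum_subset (Finset.range_subset_range.2 (Nat.lt_size_self n)) ?_
    intro i _ hi
    rw [Finset.mem_range, not_lt] at hi
    simp [Nat.choose_eq_zero_of_lt hi]
  have hterm : ∀ i, f i ∈ ((M * N * (ν + μ) ^ n : ℝ) : ℂ) • U := by
    intro i
    rcases lt_or_ge n i with hi | hi
    · have : f i = (0 : ℂ) • x := by simp [f, Nat.choose_eq_zero_of_lt hi]
      rw [this]
      exact smul_mem_smul hU (by rw [norm_zero]; positivity) hx
    · have h1 := image_mul_subset (hS i) (hT (n - i))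
      have h2 : (n.choose i : Module.End ℂ X) '' U ⊆ ((n.choose i : ℝ) : ℂ) • U := by
        have := image_smul_one_subset hU (n.choose i : ℂ)
        rw [Complex.norm_natCast] at this
        rwa [Nat.cast_smul_eq_nsmul, nsmul_one] at this
      have h3 := image_mul_subset h1 h2 (mem_image_of_mem _ hx)
      refine smul_subset_smul hU (by positivity) ?_ h3
      have h4 : ν ^ i * μ ^ (n - i) * (n.choose i) ≤ (ν + μ) ^ n := by
        rw [add_pow]
        exact Finset.single_le_sum (f := fun m => ν ^ m * μ ^ (n - m) * (n.choose m : ℝ))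
          (fun m _ => by positivity) (Finset.mem_range.2 (by omega))
      calc M * ν ^ i * (N * μ ^ (n - i)) * (n.choose i : ℝ)
          = M * N * (ν ^ i * μ ^ (n - i) * (n.choose i)) := by ring
        _ ≤ M * N * (ν + μ) ^ n := by gcongr
  rw [hsum]
  refine smul_subset_smul hU (by positivity) ?_ (sum_range_two_pow_mem_smul hp n.size f hterm)
  have h5 := hbd n
  rw [div_pow, mul_div_assoc', div_le_iff₀ (by positivity)] at h5
  calc α ^ n.size * (M * N * (ν + μ) ^ n) = M * N * (α ^ n.size * (ν + μ) ^ n) := by ring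
    _ ≤ M * N * (C * ρ ^ n) := by gcongr
    _ = C * (M * N) * ρ ^ n := by ring

theorem of_pow (hU : Balanced ℂ U) {n : ℕ} (hn : n ≠ 0) (hν : 0 < ν)
    (h : GrowthBound U (T ^ n) (ν ^ n)) (hT : GrowthBound U T μ) (hμ : 0 < μ) :
    GrowthBound U T ν := by
  obtain ⟨M, hM, h⟩ := h
  obtain ⟨N, hN, hT⟩ := hT
  -- Write `m = n * (m / n) + m % n`; the factor `max 1 (μ / ν) ^ n` pays for the at most `n - 1`
  -- remaining powers.
  refine ⟨M * (N * (max 1 (μ / ν)) ^ n), by positivity, fun m => ?_⟩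
  have h1 := image_mul_subset (h (m / n)) (hT (m % n))
  rw [← pow_mul, ← pow_add, Nat.div_add_mod] at h1
  refine h1.trans (smul_subset_smul hU (by positivity) ?_)
  have h2 : μ ^ (m % n) ≤ (max 1 (μ / ν)) ^ n * ν ^ (m % n) := by
    calc μ ^ (m % n) = (μ / ν) ^ (m % n) * ν ^ (m % n) := by
          rw [← mul_pow, div_mul_cancel₀ _ hν.ne']
      _ ≤ (max 1 (μ / ν)) ^ (m % n) * ν ^ (m % n) := by gcongr; exact le_max_right _ _
      _ ≤ _ := by
        gcongr
        · exact le_max_left _ _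
        · exact (Nat.mod_lt _ (Nat.pos_of_ne_zero hn)).le
  have h3 : ν ^ m = (ν ^ n) ^ (m / n) * ν ^ (m % n) := by
    rw [← pow_mul, ← pow_add, Nat.div_add_mod]
  calc M * (ν ^ n) ^ (m / n) * (N * μ ^ (m % n))
      ≤ M * (ν ^ n) ^ (m / n) * (N * ((max 1 (μ / ν)) ^ n * ν ^ (m % n))) := by gcongr
    _ = M * (N * (max 1 (μ / ν)) ^ n) * ν ^ m := by rw [h3]; ring

end GrowthBound

variable (U) in
/-- The growth rate of the powers of `T` on `U`. -/
noncomputable def growthRadius (T : Module.End ℂ X) : ℝ :=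
  sInf {ν : ℝ | 0 < ν ∧ GrowthBound U T ν}

theorem growthRadius_nonneg (T : Module.End ℂ X) : 0 ≤ growthRadius U T :=
  Real.sInf_nonneg fun _ h => h.1.le

theorem growthRadius_le {T : Module.End ℂ X} {ν : ℝ} (hν : 0 < ν) (h : GrowthBound U T ν) :
    growthRadius U T ≤ ν :=
  csInf_le ⟨0, fun _ h => h.1.le⟩ ⟨hν, h⟩

theorem GrowthBound.of_growthRadius_lt (hU : Balanced ℂ U) {T : Module.End ℂ X} {ν₀ : ℝ}
    (hν₀ : 0 < ν₀) (h₀ : GrowthBound U T ν₀) {ν : ℝ} (h : growthRadius U T < ν) :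
    GrowthBound U T ν := by
  have hne : {ν : ℝ | 0 < ν ∧ GrowthBound U T ν}.Nonempty := ⟨ν₀, hν₀, h₀⟩
  obtain ⟨μ, ⟨hμ, hT⟩, hlt⟩ := exists_lt_of_csInf_lt hne h
  exact hT.mono hU hμ.le hlt.le

theorem growthRadius_smul_le (hU : Balanced ℂ U) {T : Module.End ℂ X} {c : ℝ} (hc : 0 < c)
    (hT : T '' U ⊆ (c : ℂ) • U) (z : ℂ) :
    growthRadius U (z • T) ≤ ‖z‖ * growthRadius U T := by
  -- The infimum need not be attained, and `‖z‖` may be zero, so both factors are enlarged by `ε`.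
  have key : ∀ ε > 0, growthRadius U (z • T) ≤ (‖z‖ + ε) * (growthRadius U T + ε) := by
    intro ε hε
    have h1 : GrowthBound U (z • (1 : Module.End ℂ X)) (‖z‖ + ε) :=
      (GrowthBound.of_image_subset (image_smul_one_subset hU z)).mono hU (norm_nonneg z)
        (by linarith)
    have h2 : GrowthBound U T (growthRadius U T + ε) :=
      .of_growthRadius_lt hU hc (.of_image_subset hT) (by linarith)
    have h3 := h1.mul (by rw [Commute, SemiconjBy]; simp) h2
    rw [smul_mul_assoc, one_mul] at h3
    have := growthRadius_nonneg (U := U) T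
    exact growthRadius_le (by positivity) h3
  have hlim : Tendsto (fun ε : ℝ => (‖z‖ + ε) * (growthRadius U T + ε)) (𝓝[>] 0)
      (𝓝 ((‖z‖ + 0) * (growthRadius U T + 0))) :=
    ((continuous_const.add continuous_id).mul
      (continuous_const.add continuous_id)).continuousAt.tendsto.mono_left nhdsWithin_le_nhds
  simp only [add_zero] at hlim
  exact ge_of_tendsto hlim (eventually_nhdsWithin_of_forall key)

/-- The growth radius is a submultiplicative seminorm on commutative algebras of operators. -/
noncomputable def growthSeminorm {A : Type*} [CommRing A] [Algebra ℂ A]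
    (φ : A →ₐ[ℂ] Module.End ℂ X) (hU : Balanced ℂ U) (hp : IsPseudoconvex U)
    (hφ : ∀ a, ∃ c : ℝ, 0 < c ∧ φ a '' U ⊆ (c : ℂ) • U) : RingSeminorm A where
  toFun a := growthRadius U (φ a)
  map_zero' := by
    obtain ⟨c, hc, h⟩ := hφ 0
    have := growthRadius_smul_le hU hc h 0
    rw [norm_zero, zero_mul, zero_smul] at this
    rw [map_zero]
    exact le_antisymm this (growthRadius_nonneg _)
  add_le' a b := by
    obtain ⟨c, hc, ha⟩ := hφ a
    obtain ⟨d, hd, hb⟩ := hφ b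
    refine le_of_forall_pos_lt_add fun ε hε => ?_
    have h1 : GrowthBound U (φ a) (growthRadius U (φ a) + ε / 4) :=
      .of_growthRadius_lt hU hc (.of_image_subset ha) (by linarith)
    have h2 : GrowthBound U (φ b) (growthRadius U (φ b) + ε / 4) :=
      .of_growthRadius_lt hU hd (.of_image_subset hb) (by linarith)
    have n1 := growthRadius_nonneg (U := U) (φ a)
    have n2 := growthRadius_nonneg (U := U) (φ b)
    have h3 := h1.add hU hp ((Commute.all a b).map φ) h2 (by linarith) (by linarith)
      (ρ := growthRadius U (φ a) + growthRadius U (φ b) + 3 * ε / 4) (by linarith)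
    rw [← map_add] at h3
    have := growthRadius_le (by linarith) h3
    linarith
  neg' a := by
    have key : ∀ b, growthRadius U (φ (-b)) ≤ growthRadius U (φ b) := fun b => by
      obtain ⟨c, hc, h⟩ := hφ b
      simpa using growthRadius_smul_le hU hc h (-1)
    exact le_antisymm (key a) (by simpa using key (-a))
  mul_le' a b := by
    obtain ⟨c, hc, ha⟩ := hφ a
    obtain ⟨d, hd, hb⟩ := hφ b
    have key : ∀ ε > 0, growthRadius U (φ (a * b)) ≤
        (growthRadius U (φ a) + ε) * (growthRadius U (φ b) + ε) := by
      intro ε hε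
      have h1 : GrowthBound U (φ a) (growthRadius U (φ a) + ε) :=
        .of_growthRadius_lt hU hc (.of_image_subset ha) (by linarith)
      have h2 : GrowthBound U (φ b) (growthRadius U (φ b) + ε) :=
        .of_growthRadius_lt hU hd (.of_image_subset hb) (by linarith)
      have n1 := growthRadius_nonneg (U := U) (φ a)
      have n2 := growthRadius_nonneg (U := U) (φ b)
      rw [map_mul]
      exact growthRadius_le (by positivity) (h1.mul ((Commute.all a b).map φ) h2)
    have hlim : Tendsto (fun ε : ℝ => (growthRadius U (φ a) + ε) * (growthRadius U (φ b) + ε))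
        (𝓝[>] 0) (𝓝 ((growthRadius U (φ a) + 0) * (growthRadius U (φ b) + 0))) :=
      ((continuous_const.add continuous_id).mul
        (continuous_const.add continuous_id)).continuousAt.tendsto.mono_left nhdsWithin_le_nhds
    simp only [add_zero] at hlim
    exact ge_of_tendsto hlim (eventually_nhdsWithin_of_forall key)

/-- If the resolvent of `T` outside of a disc consists of operators that map `U` into multiples
of `U`, then the growth of the powers of `T` on `U` is controlled by the radius of the disc. -/
theorem GrowthBound.of_resolvent (hU : Balanced ℂ U) (hp : IsPseudoconvex U)
    {T : Module.End ℂ X} {c : ℝ} (hc : 0 < c) (hT : T '' U ⊆ (c : ℂ) • U) {ν ρ : ℝ}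
    (hν : 0 ≤ ν) (h : ν < ρ)
    (hR : ∀ z : ℂ, ν < ‖z‖ → ∃ R : Module.End ℂ X, R * (z • 1 - T) = 1 ∧ (z • 1 - T) * R = 1 ∧
      ∃ d : ℝ, 0 < d ∧ R '' U ⊆ (d : ℂ) • U) :
    GrowthBound U T ρ := by
  -- The bicommutant of `T` is commutative and contains every inverse of `z • 1 - T`; the
  -- intersection keeps only operators with finite growth on `U`.
  let B : Subalgebra ℂ (Module.End ℂ X) :=
    scalingSubalgebra U hU hp ⊓
      Subalgebra.centralizer ℂ (Subalgebra.centralizer ℂ {T} : Set (Module.End ℂ X))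
  have hTcomm : T ∈ Subalgebra.centralizer ℂ ({T} : Set (Module.End ℂ X)) := by
    rw [Subalgebra.mem_centralizer_iff]
    rintro _ rfl
    rfl
  have hBcomm : ∀ S ∈ B, S ∈ Subalgebra.centralizer ℂ ({T} : Set (Module.End ℂ X)) := by
    intro S hS
    rw [Subalgebra.mem_centralizer_iff]
    rintro _ rfl
    exact Subalgebra.mem_centralizer_iff ℂ |>.1 hS.2 _ hTcomm
  let : CommRing B :=
    { (inferInstance : Ring B) with
      mul_comm := fun a b => Subtype.ext
        (Subalgebra.mem_centralizer_iff ℂ |>.1 b.2.2 a.1 (hBcomm a.1 a.2)) }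
  let : Algebra ℂ B := B.algebra
  let φ : B →ₐ[ℂ] Module.End ℂ X := B.val
  have hTB : T ∈ B := by
    refine ⟨⟨c, hc, hT⟩, ?_⟩
    exact Subalgebra.mem_centralizer_iff ℂ |>.2 fun S hS =>
      (Subalgebra.mem_centralizer_iff ℂ |>.1 hS T rfl).symm
  have hres : ∀ z : ℂ, ν < ‖z‖ → IsUnit (algebraMap ℂ B z - ⟨T, hTB⟩) := by
    intro z hz
    obtain ⟨R, h1, h2, hd⟩ := hR z hz
    have hRB : R ∈ B := by
      refine ⟨hd, Subalgebra.mem_centralizer_iff ℂ |>.2 fun S hS => ?_⟩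
      have hS' : (z • 1 - T) * S = S * (z • 1 - T) := by
        have := Subalgebra.mem_centralizer_iff ℂ |>.1 hS T rfl
        rw [sub_mul, mul_sub, this]; simp
      calc S * R = R * ((z • 1 - T) * S) * R := by rw [← mul_assoc, h1, one_mul]
        _ = R * S * ((z • 1 - T) * R) := by rw [hS']; simp only [mul_assoc]
        _ = R * S := by rw [h2, mul_one]
    refine IsUnit.of_mul_eq_one ⟨R, hRB⟩ (Subtype.ext ?_)
    change (algebraMap ℂ (Module.End ℂ X) z - T) * R = 1
    rwa [Algebra.algebraMap_eq_smul_one]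
  have hφ : ∀ a, ∃ c : ℝ, 0 < c ∧ φ a '' U ⊆ (c : ℂ) • U := fun a => a.2.1
  obtain ⟨n, hn, hlt⟩ := exists_seminorm_pow_lt (growthSeminorm φ hU hp hφ)
    (fun z a => by
      obtain ⟨c, hc, h⟩ := hφ a
      change growthRadius U (φ (z • a)) ≤ ‖z‖ * growthRadius U (φ a)
      rw [map_smul]
      exact growthRadius_smul_le hU hc h z) ⟨T, hTB⟩ hν h hres
  change growthRadius U (T ^ n) < ρ ^ n at hlt
  obtain ⟨d, hd, hTn⟩ := hφ (⟨T, hTB⟩ ^ n)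
  exact .of_pow hU hn (hν.trans_lt h)
    (.of_growthRadius_lt hU hd (.of_image_subset hTn) hlt) (.of_image_subset hT) hc

end Growth

/-! ### Balanced and pseudo-convex zero neighborhoods -/

section Neighborhoods

variable {X : Type*} [AddCommGroup X] [Module ℂ X] [TopologicalSpace X]

theorem _root_.Bornology.IsVonNBounded.exists_subset_smul {A V : Set X}
    (hA : Bornology.IsVonNBounded ℂ A) (hV : V ∈ 𝓝 (0 : X)) :
    ∃ r : ℝ, 0 < r ∧ A ⊆ (r : ℂ) • V := by
  obtain ⟨r, hr, h⟩ := (hA hV).exists_pos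
  exact ⟨r, hr, h r (by rw [Complex.norm_real, Real.norm_of_nonneg hr.le])⟩

theorem locallyPseudoconvex_of_locallyConvexSpace [IsTopologicalAddGroup X]
    [LocallyConvexSpace ℝ X] : LocallyPseudoconvex X := by
  intro V hV
  obtain ⟨U, ⟨hU, hc⟩, hUV⟩ := (LocallyConvexSpace.convex_basis_zero ℝ X).mem_iff.1 hV
  refine ⟨U, hU, hUV, 2, two_pos, ?_⟩
  rintro _ ⟨x, hx, y, hy, rfl⟩
  refine ⟨(1 / 2 : ℝ) • x + (1 / 2 : ℝ) • y,
    hc hx hy (by norm_num) (by norm_num) (by norm_num), ?_⟩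
  have h2 : ∀ w : X, ((2 : ℝ) : ℂ) • w = (2 : ℝ) • w := fun w => rfl
  simp only [h2, smul_add, smul_smul]
  norm_num

variable [ContinuousSMul ℂ X]

theorem smul_mem_nhds_zero {V : Set X} (hV : V ∈ 𝓝 (0 : X)) {c : ℂ} (hc : c ≠ 0) :
    c • V ∈ 𝓝 (0 : X) :=
  (set_smul_mem_nhds_zero_iff hc).2 hV

/-- In a locally pseudo-convex space, the balanced pseudo-convex zero neighborhoods are a base. -/
theorem LocallyPseudoconvex.exists_balanced (hX : LocallyPseudoconvex X) {V : Set X}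
    (hV : V ∈ 𝓝 (0 : X)) :
    ∃ U ∈ 𝓝 (0 : X), U ⊆ V ∧ Balanced ℂ U ∧ IsPseudoconvex U := by
  obtain ⟨U, hU, hUV, α, hα, h⟩ := hX V hV
  refine ⟨balancedCore ℂ U, balancedCore_mem_nhds_zero hU, (balancedCore_subset U).trans hUV,
    balancedCore_balanced U, α, hα, ?_⟩
  have hα' : (α : ℂ) ≠ 0 := by exact_mod_cast hα.ne'
  -- With `C` the balanced core, `α⁻¹ • (C + C)` is balanced and contained in `U`, hence in `C`.
  rw [subset_smul_set_iff₀ hα']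
  refine (((balancedCore_balanced U).add (balancedCore_balanced U)).smul _)
    |>.subset_balancedCore_of_subset ?_
  rw [← subset_smul_set_iff₀ hα']
  exact (add_subset_add (balancedCore_subset U) (balancedCore_subset U)).trans h

/-- The multiples of the small balanced zero neighborhoods with a property `P` form a base. -/
theorem isZeroBase_of_forall_exists {P : Set X → Prop}
    (hP : ∀ V ∈ 𝓝 (0 : X), ∃ W ∈ 𝓝 (0 : X), W ⊆ V ∧ Balanced ℂ W ∧ P W) :
    IsZeroBase {V : Set X | ∃ c : ℂ, c ≠ 0 ∧ ∃ W ∈ 𝓝 (0 : X), Balanced ℂ W ∧ P W ∧ V = c • W} where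
  mem_nhds := by
    rintro _ ⟨c, hc, W, hW, -, -, rfl⟩
    exact smul_mem_nhds_zero hW hc
  exists_subset V hV := by
    obtain ⟨W, hW, hWV, hb, hPW⟩ := hP V hV
    exact ⟨W, ⟨1, one_ne_zero, W, hW, hb, hPW, (one_smul _ _).symm⟩, hWV⟩
  balanced := by
    rintro _ ⟨c, -, W, -, hb, -, rfl⟩
    exact hb.smul c
  smul_mem := by
    rintro _ ⟨c, hc, W, hW, hb, hPW, rfl⟩ d hd
    exact ⟨d * c, mul_ne_zero hd hc, W, hW, hb, hPW, smul_smul _ _ _⟩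

theorem exists_balanced_subset {U V : Set X} (hU : U ∈ 𝓝 (0 : X)) (hV : V ∈ 𝓝 (0 : X)) :
    ∃ W ∈ 𝓝 (0 : X), W ⊆ V ∧ Balanced ℂ W ∧ W ⊆ U :=
  ⟨balancedCore ℂ (U ∩ V), balancedCore_mem_nhds_zero (inter_mem hU hV),
    (balancedCore_subset _).trans inter_subset_right, balancedCore_balanced _,
    (balancedCore_subset _).trans inter_subset_left⟩

end Neighborhoods

/-! ### Coincidence of the spectra -/

section Classes

variable {X : Type*} [AddCommGroup X] [Module ℂ X] {T K : Module.End ℂ X}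

theorem spectrumIn_anti {P Q : Module.End ℂ X → Prop} (h : ∀ T, P T → Q T) (T : Module.End ℂ X) :
    spectrumIn Q T ⊆ spectrumIn P T :=
  compl_subset_compl.2 fun _ ⟨R, h1, h2, hR⟩ => ⟨R, h1, h2, h R hR⟩

theorem radiusIn_mono {C D : (ℕ → Module.End ℂ X) → Prop}
    (h : ∀ ν : ℝ, 0 < ν → C (fun n => ((ν : ℂ) ^ n)⁻¹ • K ^ n) →
      D (fun n => ((ν : ℂ) ^ n)⁻¹ • K ^ n)) : radiusIn D K ≤ radiusIn C K :=
  sInf_le_sInf (image_mono fun ν hν => ⟨hν.1, h ν hν.1 hν.2⟩)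

variable [TopologicalSpace X]

theorem bbBounded_of_continuous (h : Continuous T) : BBBounded T := fun _ hA =>
  hA.image (⟨T, h⟩ : X →L[ℂ] X)

theorem NBBoundedModScalar.nnBounded [ContinuousSMul ℂ X] (hX : LocallyPseudoconvex X)
    (h : NBBoundedModScalar T) : NNBounded T := by
  obtain ⟨z, S, ⟨U, hU, hS⟩, rfl⟩ := h
  refine ⟨_, isZeroBase_of_forall_exists (P := fun W => IsPseudoconvex W ∧ W ⊆ U) ?_, ?_⟩
  · intro V hV
    obtain ⟨W, hW, hWV, hb, hp⟩ := hX.exists_balanced (inter_mem hU hV)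
    exact ⟨W, hW, hWV.trans inter_subset_right, hb, hp, hWV.trans inter_subset_left⟩
  · rintro _ ⟨c, hc, W, hW, hb, ⟨⟨α, hα, hp⟩, hWU⟩, rfl⟩
    obtain ⟨r, hr, hSr⟩ := (hS.subset (image_mono hWU)).exists_subset_smul hW
    refine ⟨α * max ‖z‖ r, mul_pos hα (lt_max_of_lt_right hr), ?_⟩
    rw [image_smul_set, smul_comm]
    refine smul_set_mono ?_
    rintro _ ⟨x, hx, rfl⟩
    exact add_mem_smul hp (smul_mem_smul hb (le_max_left _ _) hx)
      (smul_subset_smul hb hr.le (le_max_right _ _) (hSr (mem_image_of_mem S hx)))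

variable [IsTopologicalAddGroup X]

theorem continuous_of_image_subset
    (h : ∀ V ∈ 𝓝 (0 : X), ∃ U ∈ 𝓝 (0 : X), T '' U ⊆ V) : Continuous T := by
  refine continuous_of_continuousAt_zero T ?_
  intro V hV
  rw [map_zero] at hV
  obtain ⟨U, hU, h⟩ := h V hV
  exact mem_map.2 (mem_of_superset hU (image_subset_iff.1 h))

variable [ContinuousSMul ℂ X]

theorem NNBounded.continuous (h : NNBounded T) : Continuous T := by
  obtain ⟨B, hB, h⟩ := h
  refine continuous_of_image_subset fun V hV => ?_
  obtain ⟨U, hU, hUV⟩ := hB.exists_subset V hV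
  obtain ⟨α, hα, hT⟩ := h U hU
  have hα' : (α : ℂ) ≠ 0 := by exact_mod_cast hα.ne'
  refine ⟨(α : ℂ)⁻¹ • U, smul_mem_nhds_zero (hB.mem_nhds U hU) (inv_ne_zero hα'), ?_⟩
  rw [image_smul_set, ← subset_smul_set_iff₀ hα']
  exact hT.trans (smul_set_mono hUV)

theorem NBBounded.continuous (h : NBBounded T) : Continuous T := by
  obtain ⟨U, hU, h⟩ := h
  refine continuous_of_image_subset fun V hV => ?_
  obtain ⟨r, hr, hT⟩ := h.exists_subset_smul hV
  have hr' : (r : ℂ) ≠ 0 := by exact_mod_cast hr.ne'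
  refine ⟨(r : ℂ)⁻¹ • U, smul_mem_nhds_zero hU (inv_ne_zero hr'), ?_⟩
  rwa [image_smul_set, ← subset_smul_set_iff₀ hr']

/-- A bb-bounded inverse of `zI - K` is nb-bounded modulo scalars if `K` is nb-bounded. -/
theorem BBBounded.nbBoundedModScalar_of_inverse (hK : NBBounded K) {z : ℂ}
    {R : Module.End ℂ X} (h : R * (z • 1 - K) = 1) (hR : BBBounded R) :
    NBBoundedModScalar R := by
  obtain ⟨U, hU, hKU⟩ := hK
  have hRK : Bornology.IsVonNBounded ℂ ((R * K) '' U) := by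
    have := hR _ hKU
    rwa [← image_comp] at this
  rw [mul_sub, mul_smul_comm, mul_one] at h
  -- For `z = 0` the identity `-(R * K) = 1` forces `U` itself to be bounded; otherwise `R = z⁻¹ •
  -- (1 + R * K)`.
  by_cases hz : z = 0
  · refine ⟨0, R, ⟨U, hU, hR _ ?_⟩, by rw [zero_smul, zero_add]⟩
    rw [hz, zero_smul, zero_sub] at h
    have hsub : U ⊆ -((R * K) '' U) := fun x hx =>
      Set.mem_neg.2 ⟨x, hx, neg_eq_iff_eq_neg.1 (LinearMap.congr_fun h x)⟩
    exact hRK.neg.subset hsub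
  · refine ⟨z⁻¹, z⁻¹ • (R * K), ⟨U, hU, ?_⟩, ?_⟩
    · have := hRK.image (z⁻¹ • ContinuousLinearMap.id ℂ X)
      rwa [← image_comp] at this
    · rw [← smul_add, eq_inv_smul_iff₀ hz, ← h, sub_add_cancel]

theorem spectrum_eq (hX : LocallyPseudoconvex X) (hK : NBBounded K) :
    spectrumBB K = spectrumC K ∧ spectrumC K = spectrumNN K ∧ spectrumNN K = spectrumNB K := by
  have h1 : spectrumBB K ⊆ spectrumC K := spectrumIn_anti (fun _ => bbBounded_of_continuous) K
  have h2 : spectrumC K ⊆ spectrumNN K := spectrumIn_anti (fun _ => NNBounded.continuous) K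
  have h3 : spectrumNN K ⊆ spectrumNB K :=
    spectrumIn_anti (fun _ => NBBoundedModScalar.nnBounded hX) K
  have h4 : spectrumNB K ⊆ spectrumBB K :=
    compl_subset_compl.2 fun _ ⟨R, h, h', hR⟩ => ⟨R, h, h', hR.nbBoundedModScalar_of_inverse hK h⟩
  exact ⟨h1.antisymm (h2.trans (h3.trans h4)), h2.antisymm (h3.trans (h4.trans h1)),
    h3.antisymm (h4.trans (h1.trans h2))⟩

end Classes

/-! ### Coincidence of the spectral radii -/

section Radii

variable {X : Type*} [AddCommGroup X] [Module ℂ X] [TopologicalSpace X] {K : Module.End ℂ X}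
  {S : ℕ → Module.End ℂ X}

theorem NNNull.equicontNull (h : NNNull S) : EquicontNull S := by
  obtain ⟨B, hB, h⟩ := h
  intro V hV
  obtain ⟨U, hU, hUV⟩ := hB.exists_subset V hV
  exact ⟨U, hB.mem_nhds U hU, fun ε hε => (h U hU ε hε).mono fun n hn =>
    hn.trans (smul_set_mono hUV)⟩

theorem EquicontNull.bbNull (h : EquicontNull S) : BBNull S := by
  intro A hA V hV
  obtain ⟨U, hU, h⟩ := h V hV
  obtain ⟨r, hr, hAU⟩ := hA.exists_subset_smul hU
  filter_upwards [h r⁻¹ (inv_pos.2 hr)] with n hn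
  have hr' : (r : ℂ) ≠ 0 := by exact_mod_cast hr.ne'
  calc S n '' A ⊆ S n '' ((r : ℂ) • U) := image_mono hAU
    _ = (r : ℂ) • S n '' U := image_smul_set _ _ _
    _ ⊆ (r : ℂ) • ((r⁻¹ : ℝ) : ℂ) • V := smul_set_mono hn
    _ = V := by rw [Complex.ofReal_inv, smul_inv_smul₀ hr']

theorem NBNull.nnNull [ContinuousSMul ℂ X] (h : NBNull S) : NNNull S := by
  obtain ⟨U, hU, h⟩ := h
  refine ⟨_, isZeroBase_of_forall_exists (P := fun W => W ⊆ U)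
    fun V hV => exists_balanced_subset hU hV, ?_⟩
  rintro _ ⟨c, hc, W, hW, hb, hWU, rfl⟩ ε hε
  have hε' : (ε : ℂ) ≠ 0 := by exact_mod_cast hε.ne'
  filter_upwards [h _ (smul_mem_nhds_zero hW hε')] with n hn
  rw [image_smul_set, smul_comm]
  exact smul_set_mono ((image_mono hWU).trans hn)

/-- The first factor `K` of `K ^ (n + 1)` sends a neighborhood to a bounded set, where convergence
is uniform. The index shift costs one factor `ν`. -/
theorem NBBounded.nbNull_of_bbNull [ContinuousSMul ℂ X] (hK : NBBounded K) {ν : ℝ} (hν : 0 < ν)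
    (h : BBNull fun n => ((ν : ℂ) ^ n)⁻¹ • K ^ n) : NBNull fun n => ((ν : ℂ) ^ n)⁻¹ • K ^ n := by
  obtain ⟨U, hU, hKU⟩ := hK
  refine ⟨U, hU, fun V hV => ?_⟩
  have hν' : (ν : ℂ) ≠ 0 := by exact_mod_cast hν.ne'
  have h1 := h _ hKU _ (smul_mem_nhds_zero hV hν')
  rw [← map_add_atTop_eq_nat 1, eventually_map]
  filter_upwards [h1] with n hn
  rintro _ ⟨x, hx, rfl⟩
  obtain ⟨v, hv, hvx⟩ := hn (mem_image_of_mem _ (mem_image_of_mem K hx))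
  convert hv using 1
  have : (ν : ℂ)⁻¹ • (ν : ℂ) • v = v := inv_smul_smul₀ hν' v
  simp only at hvx
  rw [← this, hvx, pow_succ, pow_succ, mul_inv_rev]
  simp [smul_smul]

theorem radius_eq [ContinuousSMul ℂ X] (hK : NBBounded K) :
    radiusBB K = radiusC K ∧ radiusC K = radiusNN K ∧ radiusNN K = radiusNB K := by
  have h1 : radiusBB K ≤ radiusC K := radiusIn_mono fun _ _ => EquicontNull.bbNull
  have h2 : radiusC K ≤ radiusNN K := radiusIn_mono fun _ _ => NNNull.equicontNull
  have h3 : radiusNN K ≤ radiusNB K := radiusIn_mono fun _ _ => NBNull.nnNull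
  have h4 : radiusNB K ≤ radiusBB K := radiusIn_mono fun _ hν => hK.nbNull_of_bbNull hν
  exact ⟨h1.antisymm (h2.trans (h3.trans h4)), h2.antisymm (h3.trans (h4.trans h1)),
    h3.antisymm (h4.trans (h1.trans h2))⟩

end Radii

/-! ### The spectrum bounds the radius -/

section SpectralRadius

variable {X : Type*} [AddCommGroup X] [Module ℂ X] [TopologicalSpace X]
  [ContinuousSMul ℂ X]

/-- Small multiples of `U` need not be small, as `U` may be unbounded. In `K * K ^ n` the outer `K`
takes them into small multiples of the bounded set `K '' U`. -/
theorem GrowthBound.nbNull {K : Module.End ℂ X} {U : Set X} (hU : U ∈ 𝓝 (0 : X))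
    (hK : Bornology.IsVonNBounded ℂ (K '' U)) {ρ ν : ℝ} (hρ : 0 < ρ)
    (h : GrowthBound U K ρ) (hρν : ρ < ν) : NBNull fun n => ((ν : ℂ) ^ n)⁻¹ • K ^ n := by
  obtain ⟨M, hM, h⟩ := h
  have hν : 0 < ν := hρ.trans hρν
  have hν' : (ν : ℂ) ≠ 0 := by exact_mod_cast hν.ne'
  refine ⟨U, hU, fun V hV => ?_⟩
  obtain ⟨r, hr, hKr⟩ := hK.exists_subset_smul (balancedCore_mem_nhds_zero (𝕜 := ℂ) hV)
  have hlim : Tendsto (fun n : ℕ => r * M / ν * (ρ / ν) ^ n) atTop (𝓝 (r * M / ν * 0)) :=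
    (tendsto_pow_atTop_nhds_zero_of_lt_one (by positivity) ((div_lt_one hν).2 hρν)).const_mul _
  rw [mul_zero] at hlim
  rw [← map_add_atTop_eq_nat 1, eventually_map]
  filter_upwards [hlim.eventually_lt_const one_pos] with n hn
  rintro _ ⟨x, hx, rfl⟩
  obtain ⟨u, hu, hux⟩ := h n (mem_image_of_mem _ hx)
  obtain ⟨v, hv, hvu⟩ := hKr (mem_image_of_mem K hu)
  simp only at hux hvu
  refine balancedCore_subset (𝕜 := ℂ) V ?_
  rw [pow_succ' K, LinearMap.smul_apply, Module.End.mul_apply, ← hux, map_smul, ← hvu,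
    smul_smul, smul_smul]
  refine (balancedCore_balanced V).smul_mem ?_ hv
  have : ((ν : ℂ) ^ (n + 1))⁻¹ * ((M * ρ ^ n : ℝ) : ℂ) * r
      = ((r * M / ν * (ρ / ν) ^ n : ℝ) : ℂ) := by
    push_cast
    rw [div_pow]
    field_simp
    ring
  rw [this, Complex.norm_real, Real.norm_of_nonneg (by positivity)]
  exact hn.le

theorem radius_le_geomRadius [IsTopologicalAddGroup X] (hX : LocallyPseudoconvex X)
    {K : Module.End ℂ X} (hK : NBBounded K) : radiusNB K ≤ geomRadius (spectrumNB K) := by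
  refine ENNReal.le_of_forall_pos_le_add ?_
  intro ε hε hfin
  obtain ⟨U₀, hU₀, hKU₀⟩ := hK
  obtain ⟨U, hU, hUU₀, hb, hp⟩ := hX.exists_balanced hU₀
  have hKU := hKU₀.subset (image_mono hUU₀)
  set s : ℝ := (geomRadius (spectrumNB K)).toReal with hs
  have hs0 : 0 ≤ s := ENNReal.toReal_nonneg
  have hε' : (0 : ℝ) < ε := hε
  obtain ⟨c, hc, hcK⟩ := hKU.exists_subset_smul hU
  have hR : ∀ z : ℂ, s + ε / 3 < ‖z‖ → ∃ R : Module.End ℂ X, R * (z • 1 - K) = 1 ∧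
      (z • 1 - K) * R = 1 ∧ ∃ d : ℝ, 0 < d ∧ R '' U ⊆ (d : ℂ) • U := by
    intro z hz
    have hz0 : z ≠ 0 := by
      rintro rfl
      rw [norm_zero] at hz
      linarith
    have hzσ : z ∉ spectrumNB K := by
      intro hmem
      have h1 : ‖z‖ₑ ≤ geomRadius (spectrumNB K) :=
        le_iSup₂ (f := fun (w : ℂ) (_ : w ∈ spectrumNB K) => ‖w‖ₑ) z hmem
      have h2 := ENNReal.toReal_mono hfin.ne h1
      rw [toReal_enorm] at h2
      linarith
    obtain ⟨R, h1, h2, hR⟩ := not_not.1 hzσ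
    refine ⟨R, h1, h2, ?_⟩
    have hRc : Continuous R := (hR.nnBounded hX).continuous
    obtain ⟨d, hd, hRd⟩ := (bbBounded_of_continuous hRc _ hKU).exists_subset_smul hU
    have hRK : R * K ∈ scalingSubalgebra U hb hp :=
      ⟨d, hd, by rwa [Module.End.coe_mul, image_comp]⟩
    -- Continuity of `R` does not control `R '' U` by `U`, but `(R * K) '' U` is bounded.
    have hReq : R = z⁻¹ • (1 + R * K) := by
      rw [mul_sub, mul_smul_comm, mul_one] at h1
      rw [eq_inv_smul_iff₀ hz0, ← h1, sub_add_cancel]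
    have : z⁻¹ • (1 + R * K) ∈ scalingSubalgebra U hb hp :=
      Subalgebra.smul_mem _ (add_mem (one_mem _) hRK) _
    rw [← hReq] at this
    exact this
  have hg := GrowthBound.of_resolvent hb hp hc hcK (by positivity)
    (show s + ε / 3 < s + ε / 2 by linarith) hR
  have hnull := hg.nbNull hU hKU (by positivity) (show s + ε / 2 < s + ε by linarith)
  have hle : radiusNB K ≤ ENNReal.ofReal (s + ε) :=
    sInf_le ⟨s + ε, ⟨by positivity, hnull⟩, rfl⟩
  rwa [ENNReal.ofReal_add hs0 hε'.le, hs, ENNReal.ofReal_toReal hfin.ne,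
    ENNReal.ofReal_coe_nnreal] at hle

end SpectralRadius

/-! ### Neumann series without completeness, and the converse bound -/

section Neumann

variable {X : Type*} [AddCommGroup X] [Module ℂ X] [TopologicalSpace X]
  [IsTopologicalAddGroup X] [ContinuousSMul ℂ X]

/-- If `P` is small on a pseudo-convex zero neighborhood and maps it into a compact set, then the
equation `y - P y = x` has a solution close to `x`: the partial sums of the Neumann series have
a cluster point. -/
theorem exists_sub_apply_eq [T2Space X] {P : Module.End ℂ X} (hP : Continuous P) {U D : Set X}
    {α : ℝ} (hU : U + U ⊆ (α : ℂ) • U) (hD : IsCompact D) (hPD : P '' U ⊆ D)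
    (hPU : P '' ((α : ℂ) • U) ⊆ U) (hlim : ∀ x, Tendsto (fun n => (P ^ n) x) atTop (𝓝 0))
    {x : X} (hx : x ∈ U) (h0 : (0 : X) ∈ U) : ∃ y, y - P y = x ∧ y - x ∈ (α : ℂ) • D := by
  set s : ℕ → X := fun n => ∑ i ∈ Finset.range n, (P ^ i) x with hs
  have hsucc : ∀ n, s (n + 1) = x + P (s n) := by
    intro n
    simp only [hs]
    rw [Finset.sum_range_succ', map_sum, add_comm]
    simp [pow_succ']
  -- Invariant of the iteration: `P` takes `α • U` into `U`, and `x + U ⊆ U + U ⊆ α • U`.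
  have hmem : ∀ n, s n ∈ (α : ℂ) • U := by
    intro n
    induction n with
    | zero => exact ⟨0, h0, by simp [hs]⟩
    | succ n ih =>
      rw [hsucc]
      exact hU (add_mem_add hx (hPU (mem_image_of_mem P ih)))
  have hD' : IsCompact ((fun v => x + v) '' ((α : ℂ) • D)) :=
    (hD.image (continuous_const_smul (α : ℂ))).image (continuous_const.add continuous_id)
  have hmem' : ∀ n, s (n + 1) ∈ (fun v => x + v) '' ((α : ℂ) • D) := by
    intro n
    rw [hsucc]
    refine mem_image_of_mem _ ?_
    have := mem_image_of_mem P (hmem n)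
    rw [image_smul_set] at this
    exact smul_set_mono hPD this
  obtain ⟨F, hF⟩ := Ultrafilter.exists_le (atTop : Filter ℕ)
  obtain ⟨y, ⟨v, hv, rfl⟩, hy⟩ := hD'.ultrafilter_le_nhds (F.map fun n => s (n + 1))
    (le_principal_iff.2 (mem_map.2 (univ_mem' hmem')))
  have hy' : Tendsto (fun n => s (n + 1)) F (𝓝 (x + v)) := hy
  refine ⟨x + v, ?_, by rwa [add_sub_cancel_left]⟩
  -- Telescoping gives `s (n + 1) - P (s (n + 1)) = x - (P ^ (n + 1)) x`, which tends to `x`.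
  have h1 : Tendsto (fun n => s (n + 1) - P (s (n + 1))) F (𝓝 ((x + v) - P (x + v))) :=
    hy'.sub ((hP.tendsto _).comp hy')
  have h2 : Tendsto (fun n => x - (P ^ (n + 1)) x) F (𝓝 (x - 0)) :=
    tendsto_const_nhds.sub (((hlim x).comp (tendsto_add_atTop_nat 1)).mono_left hF)
  rw [sub_zero] at h2
  refine tendsto_nhds_unique h1 (h2.congr fun n => ?_)
  have h3 : s (n + 1 + 1) = s (n + 1) + (P ^ (n + 1)) x := Finset.sum_range_succ _ _
  rw [hsucc (n + 1)] at h3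
  rw [sub_eq_sub_iff_add_eq_add, h3]

/-- The operator `1 - P` has a continuous inverse if `P` is small on a pseudo-convex zero
neighborhood and maps it into a compact set. -/
theorem exists_continuous_inverse_one_sub [T2Space X] {P : Module.End ℂ X} {U D : Set X}
    (hU0 : U ∈ 𝓝 (0 : X)) {α : ℝ} (hU : U + U ⊆ (α : ℂ) • U) (hD : IsCompact D)
    (hPD : P '' U ⊆ D) (hPU : P '' ((α : ℂ) • U) ⊆ U)
    (hlim : ∀ x, Tendsto (fun n => (P ^ n) x) atTop (𝓝 0)) :
    ∃ Q : Module.End ℂ X, Q * (1 - P) = 1 ∧ (1 - P) * Q = 1 ∧ Continuous Q := by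
  have hP : Continuous P := NBBounded.continuous ⟨U, hU0, (hD.isVonNBounded ℂ).subset hPD⟩
  have hsol : ∀ x ∈ U, ∃ y, y - P y = x ∧ y - x ∈ (α : ℂ) • D := fun x hx =>
    exists_sub_apply_eq hP hU hD hPD hPU hlim hx (mem_of_mem_nhds hU0)
  have hinj : Function.Injective (1 - P : Module.End ℂ X) := by
    rw [← LinearMap.ker_eq_bot, LinearMap.ker_eq_bot']
    intro y hy
    have hPy : P y = y := (sub_eq_zero.1 hy).symm
    have hpow : ∀ n, (P ^ n) y = y := by
      intro n
      induction n with
      | zero => rfl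
      | succ n ih => rw [pow_succ, Module.End.mul_apply, hPy, ih]
    have := hlim y
    simp only [hpow] at this
    exact tendsto_nhds_unique tendsto_const_nhds this
  have hsurj : Function.Surjective (1 - P : Module.End ℂ X) := by
    intro x
    obtain ⟨r, hr, hxr⟩ :=
      (Bornology.isVonNBounded_singleton (𝕜 := ℂ) x).exists_subset_smul hU0
    obtain ⟨u, hu, hux⟩ := hxr rfl
    obtain ⟨y, hy, -⟩ := hsol u hu
    refine ⟨(r : ℂ) • y, ?_⟩
    rw [map_smul, ← hux]
    exact congrArg _ hy
  let e := LinearEquiv.ofBijective (1 - P : Module.End ℂ X) ⟨hinj, hsurj⟩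
  have he : ∀ x, (1 - P : Module.End ℂ X) (e.symm x) = x := fun x => e.apply_symm_apply x
  have he' : ∀ x, e.symm ((1 - P : Module.End ℂ X) x) = x := fun x => e.symm_apply_apply x
  -- The solution differs from `x ∈ U` by an element of the compact set `α • D`; this yields
  -- continuity of the inverse.
  have hcomp : NBBounded ((e.symm : Module.End ℂ X) - 1) := by
    refine ⟨U, hU0, ?_⟩
    have hD' : IsCompact ((α : ℂ) • D) := hD.image (continuous_const_smul (α : ℂ))
    refine (hD'.isVonNBounded ℂ).subset ?_
    rintro _ ⟨x, hx, rfl⟩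
    obtain ⟨y, hy, hyx⟩ := hsol x hx
    have : e.symm x = y := by rw [← hy]; exact he' y
    change e.symm x - x ∈ _
    rwa [this]
  refine ⟨e.symm, LinearMap.ext he', LinearMap.ext he, ?_⟩
  have := hcomp.continuous.add continuous_id
  refine this.congr fun x => ?_
  exact sub_add_cancel (e.symm x) x

/-- For compact `K`, a point outside of the disc where `K ^ n / ν ^ n` tends to zero is a regular
point. -/
theorem norm_le_of_mem_spectrumC [T2Space X] (hX : LocallyPseudoconvex X) {K : Module.End ℂ X}
    (hK : IsCompactOperator K) {ν : ℝ} (hν : 0 < ν)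
    (hnull : NBNull fun n => ((ν : ℂ) ^ n)⁻¹ • K ^ n) {z : ℂ} (hz : z ∈ spectrumC K) :
    ‖z‖ ≤ ν := by
  by_contra! hlt
  refine hz ?_
  have hz0 : z ≠ 0 := norm_pos_iff.1 (hν.trans hlt)
  have hν' : (ν : ℂ) ≠ 0 := by exact_mod_cast hν.ne'
  obtain ⟨C, hC, hKC⟩ := hK
  have hKcont : Continuous K :=
    NBBounded.continuous ⟨_, hKC, (hC.isVonNBounded ℂ).subset (image_preimage_subset K C)⟩
  obtain ⟨U₀, hU₀, hnull⟩ := hnull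
  set T : Module.End ℂ X := z⁻¹ • K with hT
  have hTcont : Continuous T := hKcont.const_smul z⁻¹
  have hTnull : ∀ V ∈ 𝓝 (0 : X), ∀ᶠ n : ℕ in atTop, (T ^ n) '' U₀ ⊆ V := by
    intro V hV
    filter_upwards [hnull _ (balancedCore_mem_nhds_zero (𝕜 := ℂ) hV)] with n hn
    rintro _ ⟨x, hx, rfl⟩
    refine balancedCore_subset (𝕜 := ℂ) V ?_
    have h1 : (T ^ n) x = (ν / z) ^ n • (((ν : ℂ) ^ n)⁻¹ • K ^ n) x := by
      rw [hT, smul_pow, LinearMap.smul_apply, LinearMap.smul_apply, smul_smul]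
      rw [div_pow, inv_pow]
      congr 1
      field_simp
    rw [h1]
    refine (balancedCore_balanced V).smul_mem ?_ (hn (mem_image_of_mem _ hx))
    rw [norm_pow, norm_div, Complex.norm_real, Real.norm_of_nonneg hν.le]
    exact pow_le_one₀ (by positivity) ((div_le_one (hν.trans hlt)).2 hlt.le)
  obtain ⟨U, hU, hUsub, -, α, hα, hαU⟩ := hX.exists_balanced (inter_mem hU₀ hKC)
  have hα' : (α : ℂ) ≠ 0 := by exact_mod_cast hα.ne'
  -- The factor `α⁻¹` makes the power map `α • U` into `U`; `n ≥ 1` leaves one factor `T` to provide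
  -- compactness.
  obtain ⟨n, hn, hn1⟩ := ((hTnull _ (smul_mem_nhds_zero hU (inv_ne_zero hα'))).and
    (eventually_ge_atTop 1)).exists
  obtain ⟨m, rfl⟩ : ∃ m, n = m + 1 := ⟨n - 1, by omega⟩
  have hpow_cont : ∀ k : ℕ, Continuous (T ^ k : Module.End ℂ X) := fun k => by
    rw [Module.End.coe_pow]
    exact hTcont.iterate k
  have hTlim : ∀ x, Tendsto (fun n => (T ^ n) x) atTop (𝓝 0) := by
    intro x
    obtain ⟨r, hr, hxr⟩ :=
      (Bornology.isVonNBounded_singleton (𝕜 := ℂ) x).exists_subset_smul hU₀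
    obtain ⟨u, hu, rfl⟩ := hxr rfl
    have h1 : Tendsto (fun n => (T ^ n) u) atTop (𝓝 0) := fun V hV =>
      (hTnull V hV).mono fun n hn => hn (mem_image_of_mem _ hu)
    simpa using h1.const_smul (r : ℂ)
  obtain ⟨Q, hQ1, hQ2, hQ⟩ := exists_continuous_inverse_one_sub (P := T ^ (m + 1)) (U := U)
    (D := (T ^ m) '' (z⁻¹ • C)) hU hαU
    ((hC.image (continuous_const_smul z⁻¹)).image (hpow_cont m))
    (by
      rintro _ ⟨x, hx, rfl⟩
      rw [pow_succ]
      exact mem_image_of_mem _ (smul_mem_smul_set (hUsub hx).2))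
    (by
      rw [image_smul_set, ← inv_inv (α : ℂ), ← subset_smul_set_iff₀ (inv_ne_zero hα')]
      exact (image_mono fun x hx => (hUsub hx).1).trans hn)
    (fun x => by
      simp only [← pow_mul]
      exact (hTlim x).comp (tendsto_id.const_mul_atTop' (Nat.succ_pos m)))
  set G : Module.End ℂ X := ∑ i ∈ Finset.range (m + 1), T ^ i with hG
  have hGl : G * (1 - T) = 1 - T ^ (m + 1) := geom_sum_mul_neg T (m + 1)
  have hGr : (1 - T) * G = 1 - T ^ (m + 1) := mul_neg_geom_sum T (m + 1)
  have hGcont : Continuous G := by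
    have : (G : X → X) = fun x => ∑ i ∈ Finset.range (m + 1), (T ^ i) x := by
      ext x
      simp [hG]
    rw [this]
    exact continuous_finsetSum _ fun i _ => hpow_cont i
  have hzT : z • (1 : Module.End ℂ X) - K = z • (1 - T) := by
    rw [smul_sub, hT, smul_inv_smul₀ hz0]
  have hleft : (Q * G) * (1 - T) = 1 := by rw [mul_assoc, hGl, hQ1]
  have hright : (1 - T) * (G * Q) = 1 := by rw [← mul_assoc, hGr, hQ2]
  -- A left and a right inverse of `1 - T` agree, so no separate proof that `Q` and `G` commute is
  -- needed.
  have heq : Q * G = G * Q := left_inv_eq_right_inv hleft hright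
  refine ⟨z⁻¹ • (Q * G), ?_, ?_, ?_⟩
  · rw [hzT, smul_mul_smul_comm, inv_mul_cancel₀ hz0, one_smul, hleft]
  · rw [hzT, heq, smul_mul_smul_comm, mul_inv_cancel₀ hz0, one_smul, hright]
  · exact (hQ.comp hGcont).const_smul z⁻¹

theorem geomRadius_le_radius [T2Space X] (hX : LocallyPseudoconvex X) {K : Module.End ℂ X}
    (hK : IsCompactOperator K) : geomRadius (spectrumC K) ≤ radiusNB K := by
  refine le_sInf ?_
  rintro _ ⟨ν, ⟨hν, hnull⟩, rfl⟩
  refine iSup₂_le fun z hz => ?_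
  rw [← ofReal_norm]
  exact ENNReal.ofReal_le_ofReal (norm_le_of_mem_spectrumC hX hK hν hnull hz)

end Neumann

end TVSOp

theorem mainTheorem3 {X : Type*} [AddCommGroup X] [Module ℂ X] [TopologicalSpace X]
    [IsTopologicalAddGroup X] [ContinuousSMul ℂ X] [T2Space X]
    (hX : LocallyConvexSpace ℝ X ∨ TVSOp.LocallyPseudoconvex X)
    (K : Module.End ℂ X) (hK : IsCompactOperator K) :
    (TVSOp.spectrumBB K = TVSOp.spectrumC K ∧ TVSOp.spectrumC K = TVSOp.spectrumNN K ∧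
      TVSOp.spectrumNN K = TVSOp.spectrumNB K) ∧
    (TVSOp.radiusBB K = TVSOp.radiusC K ∧ TVSOp.radiusC K = TVSOp.radiusNN K ∧
      TVSOp.radiusNN K = TVSOp.radiusNB K) ∧
    TVSOp.radiusNB K = TVSOp.geomRadius (TVSOp.spectrumNB K) := by
  have hX' : TVSOp.LocallyPseudoconvex X :=
    hX.elim (fun _ => TVSOp.locallyPseudoconvex_of_locallyConvexSpace) id
  have hKnb : TVSOp.NBBounded K := by
    obtain ⟨C, hC, hKC⟩ := hK
    exact ⟨_, hKC, (hC.isVonNBounded ℂ).subset (Set.image_preimage_subset K C)⟩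
  have hσ := TVSOp.spectrum_eq hX' hKnb
  refine ⟨hσ, TVSOp.radius_eq hKnb, (TVSOp.radius_le_geomRadius hX' hKnb).antisymm ?_⟩
  rw [← hσ.2.2, ← hσ.2.1]
  exact TVSOp.geomRadius_le_radius hX' hK
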